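/- Let $Z_1,Z_2,Z_3\in\mathbb R^3$ be three points that do not lie on a common line, and let $d_1,d_2,d_3\ge 0$ be real numbers. Define $$O(W)=\sum_{i=1}^3\bigl|\,\|W-Z_i\|^2-d_i^2\,\bigr|\qquad(W\in\mathbb R^3),$$ where $\|\cdot\|$ is the Euclidean norm, and let $$X=\{W\in\mathbb R^3 : O(W)\le O(V)\text{ for all }V\in\mathbb R^3\}$$ be the set of its global minimizers. Let $S_i$ be the boundary of the closed ball with center $Z_i$ and radius $d_i$ (so $S_i=\{Z_i\}$ if $d_i=0$), and let $S_{123}=S_1\cap S_2\cap S_3$. Then the number $|X|$ of elements of $X$ is $1$ or $2$. Moreover, $|X|=1$ if $|S_{123}|$ is $0$ or $1$, and $|X|=2$ if $|S_{123}|=2$. -/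

import Mathlib

/-- Points of `ℝⁿ` with the Euclidean norm. -/
abbrev Pt (n : ℕ) : Type := EuclideanSpace ℝ (Fin n)

/-- The objective function `O(W) = ∑ i, |ψ(‖W - Z i‖) - ψ(d i)|` for sensors at `Z i` and
measured distances `d i`. -/
noncomputable def objective {n I : ℕ} (ψ : ℝ → ℝ) (Z : Fin I → Pt n) (d : Fin I → ℝ)
    (W : Pt n) : ℝ :=
  ∑ i, |ψ ‖W - Z i‖ - ψ (d i)|

/-- The squared distance error `ψ(y) = y²`. -/
def sqError (y : ℝ) : ℝ := y ^ 2

/-- The set `X` of all global minimizers of the objective function over `ℝⁿ`. -/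
def minimizers {n I : ℕ} (ψ : ℝ → ℝ) (Z : Fin I → Pt n) (d : Fin I → ℝ) : Set (Pt n) :=
  {W | ∀ V : Pt n, objective ψ Z d W ≤ objective ψ Z d V}

/-- The measurement closed ball `D i`, centered at `Z i` with radius `d i`. -/
def measBall {n I : ℕ} (Z : Fin I → Pt n) (d : Fin I → ℝ) (i : Fin I) : Set (Pt n) :=
  Metric.closedBall (Z i) (d i)

/-- The measurement sphere `S i`, the boundary of `D i`. -/
def measSphere {n I : ℕ} (Z : Fin I → Pt n) (d : Fin I → ℝ) (i : Fin I) : Set (Pt n) :=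
  frontier (measBall Z d i)

/-- The common intersection of all measurement spheres; for three sensors this is
`S₁₂₃ = S₁ ∩ S₂ ∩ S₃`. -/
def commonSphere {n I : ℕ} (Z : Fin I → Pt n) (d : Fin I → ℝ) : Set (Pt n) :=
  ⋂ i, measSphere Z d i

theorem measSphere_eq_sphere {I : ℕ} (Z : Fin I → Pt 3) (d : Fin I → ℝ) (i : Fin I) :
    measSphere Z d i = Metric.sphere (Z i) (d i) :=
  frontier_closedBall' (Z i) (d i)

/-! Let `F W = (‖W - Z i‖²)ᵢ`, so that the objective is the ℓ¹ distance from `F W` to `(d i ^ 2)ᵢ`,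
a convex function of `F W`. Off the plane of the centers the differential of `F` is invertible, so a
positive value can be lowered there (`objective_eq_zero_of_off_plane`). The mean of `F A` and `F B`
with `A ≠ B` is again a value of `F`, at a point off that plane (`exists_off_plane_mean`). Two
distinct minimizers thus yield an off-plane minimizer, whose objective is zero: if the spheres have
no common point, the minimizer is unique. Otherwise the minimizers are the common points, at most
two since they are mirror images in the plane. -/

open Filter Topology in
/-- The objective function attains its minimum. -/
theorem minimizers_nonempty (Z : Fin 3 → Pt 3) (d : Fin 3 → ℝ) :
    (minimizers sqError Z d).Nonempty := by
  have hcont : Continuous (objective sqError Z d) := by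
    unfold objective sqError
    fun_prop
  have hlim : Tendsto (objective sqError Z d) (cocompact (Pt 3)) atTop := by
    have h1 : Tendsto (fun W : Pt 3 => dist W (Z 0)) (cocompact _) atTop :=
      tendsto_dist_right_cocompact_atTop (Z 0)
    have h2 : Tendsto (fun W : Pt 3 => dist W (Z 0) ^ 2 + -(d 0 ^ 2)) (cocompact _) atTop :=
      tendsto_atTop_add_const_right _ _ ((tendsto_pow_atTop two_ne_zero).comp h1)
    refine tendsto_atTop_mono (fun W => ?_) h2
    have h3 : |sqError ‖W - Z 0‖ - sqError (d 0)| ≤ objective sqError Z d W :=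
      Finset.single_le_sum (f := fun i => |sqError ‖W - Z i‖ - sqError (d i)|)
        (fun i _ => abs_nonneg _) (Finset.mem_univ 0)
    refine le_trans ?_ h3
    rw [dist_eq_norm]
    exact le_abs_self _
  obtain ⟨W, hW⟩ := hcont.exists_forall_le hlim
  exact ⟨W, hW⟩

/-- A plane in space has a unit normal, which spans the orthogonal complement. -/
theorem exists_unit_normal (Z : Fin 3 → Pt 3) (hZ : ¬ Collinear ℝ {Z 0, Z 1, Z 2}) :
    ∃ n : Pt 3, ‖n‖ = 1 ∧ (∀ i, inner ℝ n (Z i - Z 0) = 0) ∧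
      ∀ x : Pt 3, (∀ i, inner ℝ x (Z i - Z 0) = 0) → ∃ c : ℝ, x = c • n := by
  have hS : Module.finrank ℝ (vectorSpan ℝ (Set.range Z)) = 2 := by
    have hA : AffineIndependent ℝ Z := by
      have h := affineIndependent_iff_not_collinear_set.2 hZ
      have hvec : ![Z 0, Z 1, Z 2] = Z := by
        funext i
        fin_cases i <;> rfl
      rwa [hvec] at h
    exact hA.finrank_vectorSpan (by simp)
  have hmem : ∀ x : Pt 3, x ∈ (vectorSpan ℝ (Set.range Z))ᗮ ↔
      ∀ i, inner ℝ x (Z i - Z 0) = 0 := by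
    intro x
    rw [vectorSpan_range_eq_span_range_vsub_right ℝ Z 0, Submodule.mem_orthogonal']
    constructor
    · intro h i
      exact h _ (Submodule.subset_span ⟨i, rfl⟩)
    · intro h u hu
      induction hu using Submodule.span_induction with
      | mem y hy =>
        obtain ⟨i, rfl⟩ := hy
        exact h i
      | zero => exact inner_zero_right _
      | add y z _ _ hy hz => rw [inner_add_right, hy, hz, add_zero]
      | smul c y _ hy => rw [inner_smul_right, hy, mul_zero]
  have hO : Module.finrank ℝ (vectorSpan ℝ (Set.range Z))ᗮ = 1 := by
    have h := (vectorSpan ℝ (Set.range Z)).finrank_add_finrank_orthogonal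
    rw [hS, finrank_euclideanSpace_fin] at h
    omega
  obtain ⟨⟨v, hv⟩, hv0, hspan⟩ := finrank_eq_one_iff'.1 hO
  have hv0' : v ≠ 0 := fun h => hv0 (Subtype.ext h)
  have hnv : ‖v‖ ≠ 0 := norm_ne_zero_iff.2 hv0'
  refine ⟨‖v‖⁻¹ • v, ?_, ?_, ?_⟩
  · rw [norm_smul, norm_inv, norm_norm, inv_mul_cancel₀ hnv]
  · exact (hmem _).1 (Submodule.smul_mem _ _ hv)
  · intro x hx
    obtain ⟨c, hc⟩ := hspan ⟨x, (hmem x).2 hx⟩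
    have hc' : c • v = x := congrArg Subtype.val hc
    refine ⟨c * ‖v‖, ?_⟩
    rw [smul_smul, mul_assoc, mul_inv_cancel₀ hnv, mul_one, hc']

/-- Off the plane of the centers, the vectors `W - Z i` are independent, so their inner products
with a vector can be prescribed. -/
theorem exists_inner_sub_eq (Z : Fin 3 → Pt 3) (n : Pt 3)
    (hspan : ∀ x : Pt 3, (∀ i, inner ℝ x (Z i - Z 0) = 0) → ∃ c : ℝ, x = c • n)
    (W : Pt 3) (hW : inner ℝ n (W - Z 0) ≠ 0) (g : Fin 3 → ℝ) :
    ∃ v : Pt 3, ∀ i, inner ℝ (W - Z i) v = g i := by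
  let L : Pt 3 →ₗ[ℝ] (Fin 3 → ℝ) := LinearMap.pi fun i => (innerₛₗ ℝ (W - Z i))
  have hL : ∀ v i, L v i = inner ℝ (W - Z i) v := fun v i => rfl
  -- A kernel vector is orthogonal to every `Z i - Z 0`, hence equals `c • n`; `hW` then forces `c =
  -- 0`.
  have hinj : Function.Injective L := by
    rw [injective_iff_map_eq_zero]
    intro x hx
    have hx' : ∀ i, inner ℝ x (W - Z i) = 0 := fun i => by
      rw [real_inner_comm, ← hL, hx, Pi.zero_apply]
    obtain ⟨c, rfl⟩ := hspan x fun i => by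
      rw [← sub_sub_sub_cancel_left (Z 0) (Z i) W, inner_sub_right, hx', hx', sub_zero]
    have h0 := hx' 0
    rw [real_inner_smul_left] at h0
    rw [(mul_eq_zero.1 h0).resolve_right hW, zero_smul]
  have hsurj : Function.Surjective L :=
    (LinearMap.injective_iff_surjective_of_finrank_eq_finrank (by simp)).1 hinj
  obtain ⟨v, hv⟩ := hsurj g
  exact ⟨v, fun i => by rw [← hL, hv]⟩

/-- A minimizer off the plane of the centers has objective value zero. -/
theorem objective_eq_zero_of_off_plane (Z : Fin 3 → Pt 3) (d : Fin 3 → ℝ) (n : Pt 3)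
    (hspan : ∀ x : Pt 3, (∀ i, inner ℝ x (Z i - Z 0) = 0) → ∃ c : ℝ, x = c • n)
    (W : Pt 3) (hW : inner ℝ n (W - Z 0) ≠ 0) (hmin : W ∈ minimizers sqError Z d) :
    objective sqError Z d W = 0 := by
  -- Along `v`, each residual is scaled by `1 - 2 * t` to first order; the only error is `t ^ 2 *
  -- ‖v‖ ^ 2`.
  obtain ⟨v, hv⟩ := exists_inner_sub_eq Z n hspan W hW
    fun i => -(sqError ‖W - Z i‖ - sqError (d i))
  have hO : 0 ≤ objective sqError Z d W := Finset.sum_nonneg fun i _ => abs_nonneg _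
  have key : ∀ t : ℝ, 0 ≤ t → t ≤ 1 / 2 →
      2 * t * objective sqError Z d W ≤ 3 * (t ^ 2 * ‖v‖ ^ 2) := by
    intro t ht0 ht1
    have h1 : objective sqError Z d (W + t • v) ≤
        ∑ i, ((1 - 2 * t) * |sqError ‖W - Z i‖ - sqError (d i)| + t ^ 2 * ‖v‖ ^ 2) := by
      refine Finset.sum_le_sum fun i _ => ?_
      have h2 : sqError ‖W + t • v - Z i‖ - sqError (d i) =
          (1 - 2 * t) * (sqError ‖W - Z i‖ - sqError (d i)) + t ^ 2 * ‖v‖ ^ 2 := by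
        have h3 : W + t • v - Z i = (W - Z i) + t • v := by abel
        have h4 := hv i
        unfold sqError at h4 ⊢
        rw [h3, norm_add_sq_real, real_inner_smul_right, h4, norm_smul, mul_pow,
          Real.norm_eq_abs, sq_abs]
        ring
      rw [h2]
      refine (abs_add_le _ _).trans ?_
      rw [abs_mul, abs_of_nonneg (by linarith : 0 ≤ 1 - 2 * t),
        abs_of_nonneg (by positivity : 0 ≤ t ^ 2 * ‖v‖ ^ 2)]
    rw [Finset.sum_add_distrib, ← Finset.mul_sum] at h1
    have h5 := hmin (W + t • v)
    have h6 : ∑ i, |sqError ‖W - Z i‖ - sqError (d i)| = objective sqError Z d W := rfl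
    rw [h6] at h1
    simp only [Finset.sum_const, Finset.card_univ, Fintype.card_fin, nsmul_eq_mul] at h1
    push_cast at h1
    linarith
  by_contra hne
  have hpos : 0 < objective sqError Z d W := lt_of_le_of_ne hO (Ne.symm hne)
  set m := objective sqError Z d W
  set q := ‖v‖ ^ 2
  have hq : 0 ≤ q := by positivity
  have hD : 0 < 2 * m + 3 * q := by positivity
  -- This `t` is at most `1 / 2` and satisfies `3 * t * q ≤ m`, whereas `key` divided by `t` gives
  -- `2 * m ≤ 3 * t * q`.
  have hk := key (m / (2 * m + 3 * q)) (by positivity) (by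
    rw [div_le_div_iff₀ hD two_pos]; linarith)
  have ht : 0 < m / (2 * m + 3 * q) := by positivity
  have hk2 : 2 * m ≤ 3 * (m / (2 * m + 3 * q)) * q := by
    refine le_of_mul_le_mul_left ?_ ht
    linarith
  have hk3 : 3 * (m / (2 * m + 3 * q)) * q ≤ m := by
    have h7 : 3 * (m / (2 * m + 3 * q)) * q = m * (3 * q) / (2 * m + 3 * q) := by ring
    rw [h7, div_le_iff₀ hD]
    nlinarith
  linarith

/-- For two distinct points there is a point off the plane of the centers whose squared distances
to the centers are the means of those of the two points. -/
theorem exists_off_plane_mean (Z : Fin 3 → Pt 3) (n : Pt 3) (hn : ‖n‖ = 1)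
    (horth : ∀ i, inner ℝ n (Z i - Z 0) = 0) (A B : Pt 3) (hAB : A ≠ B) :
    ∃ M : Pt 3, inner ℝ n (M - Z 0) ≠ 0 ∧
      ∀ i, ‖M - Z i‖ ^ 2 = (‖A - Z i‖ ^ 2 + ‖B - Z i‖ ^ 2) / 2 := by
  set C : Pt 3 := (2⁻¹ : ℝ) • (A + B) with hC
  set h : ℝ := inner ℝ n (C - Z 0) with hh
  -- By the parallelogram law, the midpoint `C` falls short of each mean by the same `‖A - B‖ ^ 2 /
  -- 4`. Moving along the normal from height `h` to `√r` adds exactly this to every squared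
  -- distance, and `√r > 0` since `A ≠ B`.
  set r : ℝ := h ^ 2 + ‖A - B‖ ^ 2 / 4 with hr
  have hAB' : 0 < ‖A - B‖ := norm_pos_iff.2 (sub_ne_zero.2 hAB)
  have hr0 : 0 < r := by positivity
  have hnn : inner ℝ n n = (1 : ℝ) := by rw [real_inner_self_eq_norm_sq, hn, one_pow]
  refine ⟨C + (√r - h) • n, ?_, fun i => ?_⟩
  · have h1 : C + (√r - h) • n - Z 0 = (C - Z 0) + (√r - h) • n := by abel
    rw [h1, inner_add_right, inner_smul_right, hnn, ← hh, mul_one, add_sub_cancel]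
    exact (Real.sqrt_pos.2 hr0).ne'
  · have h1 : C + (√r - h) • n - Z i = (C - Z i) + (√r - h) • n := by abel
    have h2 : inner ℝ (C - Z i) n = h := by
      rw [real_inner_comm, ← sub_sub_sub_cancel_right C (Z i) (Z 0), inner_sub_right, horth,
        sub_zero]
    have h3 : C - Z i = (2⁻¹ : ℝ) • ((A - Z i) + (B - Z i)) := by
      rw [hC]; module
    have h4 : A - B = (A - Z i) - (B - Z i) := by abel
    have h5 : √r ^ 2 = h ^ 2 + ‖A - B‖ ^ 2 / 4 := Real.sq_sqrt hr0.le
    have h6 := parallelogram_law_with_norm ℝ (A - Z i) (B - Z i)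
    rw [← h4] at h6
    have h7 : ‖C - Z i‖ = 2⁻¹ * ‖(A - Z i) + (B - Z i)‖ := by
      rw [h3, norm_smul, Real.norm_of_nonneg (by norm_num)]
    rw [h1, norm_add_sq_real, inner_smul_right, h2, norm_smul, hn, mul_one, Real.norm_eq_abs,
      sq_abs, h7]
    linarith

/-- The objective function vanishes exactly on the intersection of the spheres. -/
theorem mem_commonSphere_iff (Z : Fin 3 → Pt 3) (d : Fin 3 → ℝ) (hd : ∀ i, 0 ≤ d i) (W : Pt 3) :
    W ∈ commonSphere Z d ↔ objective sqError Z d W = 0 := by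
  unfold commonSphere objective sqError
  rw [Set.mem_iInter, Finset.sum_eq_zero_iff_of_nonneg fun i _ => abs_nonneg _]
  refine forall_congr' fun i => ?_
  rw [measSphere_eq_sphere, mem_sphere_iff_norm, abs_eq_zero, sub_eq_zero,
    pow_left_inj₀ (norm_nonneg _) (hd i) two_ne_zero]
  simp

/-- If the spheres meet, the minimizers are their common points. -/
theorem minimizers_eq_commonSphere (Z : Fin 3 → Pt 3) (d : Fin 3 → ℝ) (hd : ∀ i, 0 ≤ d i)
    (hne : (commonSphere Z d).Nonempty) : minimizers sqError Z d = commonSphere Z d := by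
  obtain ⟨U, hU⟩ := hne
  rw [mem_commonSphere_iff Z d hd] at hU
  have hnonneg : ∀ V, 0 ≤ objective sqError Z d V := fun V =>
    Finset.sum_nonneg fun i _ => abs_nonneg _
  ext W
  rw [mem_commonSphere_iff Z d hd]
  exact ⟨fun hW => le_antisymm (hU ▸ hW U) (hnonneg W), fun hW V => hW ▸ hnonneg V⟩

/-- If the spheres have no common point, there is exactly one minimizer. -/
theorem minimizers_encard_eq_one (Z : Fin 3 → Pt 3) (hZ : ¬ Collinear ℝ {Z 0, Z 1, Z 2})
    (d : Fin 3 → ℝ) (hd : ∀ i, 0 ≤ d i) (he : commonSphere Z d = ∅) :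
    (minimizers sqError Z d).encard = 1 := by
  obtain ⟨n, hn, horth, hspan⟩ := exists_unit_normal Z hZ
  obtain ⟨A, hA⟩ := minimizers_nonempty Z d
  rw [Set.encard_eq_one]
  refine ⟨A, Set.eq_singleton_iff_unique_mem.2 ⟨hA, fun B hB => ?_⟩⟩
  by_contra hBA
  obtain ⟨M, hM, hmean⟩ := exists_off_plane_mean Z n hn horth B A hBA
  have hle : objective sqError Z d M ≤
      (objective sqError Z d B + objective sqError Z d A) / 2 := by
    unfold objective
    rw [← Finset.sum_add_distrib, Finset.sum_div]
    refine Finset.sum_le_sum fun i _ => ?_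
    have h1 : sqError ‖M - Z i‖ - sqError (d i) = ((sqError ‖B - Z i‖ - sqError (d i)) +
        (sqError ‖A - Z i‖ - sqError (d i))) / 2 := by
      have h2 := hmean i
      unfold sqError
      linarith
    rw [h1, abs_div, abs_two]
    gcongr
    exact abs_add_le _ _
  have hMmin : M ∈ minimizers sqError Z d := fun V => by
    have h1 := hA V
    have h2 := hB V
    linarith
  have hM0 := objective_eq_zero_of_off_plane Z d n hspan M hM hMmin
  rw [← mem_commonSphere_iff Z d hd, he] at hM0
  exact hM0

/-- Three spheres with non-collinear centers have at most two common points. -/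
theorem commonSphere_encard_le_two (Z : Fin 3 → Pt 3) (hZ : ¬ Collinear ℝ {Z 0, Z 1, Z 2})
    (d : Fin 3 → ℝ) : (commonSphere Z d).encard ≤ 2 := by
  obtain ⟨n, hn, -, hspan⟩ := exists_unit_normal Z hZ
  rcases (commonSphere Z d).eq_empty_or_nonempty with he | ⟨A, hA⟩
  · simp [he]
  have hmem : ∀ W ∈ commonSphere Z d, ∀ i, ‖W - Z i‖ = d i := fun W hW i => by
    have h := Set.mem_iInter.1 hW i
    rwa [measSphere_eq_sphere, mem_sphere_iff_norm] at h
  -- The second point is the reflection of `A` in the plane of the centers.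
  have hsub : commonSphere Z d ⊆ {A, A - (2 * inner ℝ n (A - Z 0)) • n} := by
    intro B hB
    have hdiff : ∀ i, 2 * inner ℝ (A - B) (A - Z i) = ‖A - B‖ ^ 2 := fun i => by
      have h1 : B - Z i = (A - Z i) - (A - B) := by abel
      have h2 : ‖B - Z i‖ ^ 2 = ‖A - Z i‖ ^ 2 := by rw [hmem A hA, hmem B hB]
      rw [h1, norm_sub_sq_real, real_inner_comm] at h2
      linarith
    -- The right side of `hdiff` does not depend on `i`, so `A - B` is normal to the plane.
    obtain ⟨c, hc⟩ := hspan (A - B) fun i => by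
      rw [← sub_sub_sub_cancel_left (Z 0) (Z i) A, inner_sub_right]
      linarith [hdiff i, hdiff 0]
    have h0 := hdiff 0
    rw [hc, real_inner_smul_left, norm_smul, hn, mul_one, Real.norm_eq_abs, sq_abs] at h0
    have hB' : B = A - c • n := by rw [← hc]; abel
    by_cases hc0 : c = 0
    · left
      rw [hB', hc0, zero_smul, sub_zero]
    · right
      have hc2 : 2 * inner ℝ n (A - Z 0) = c := by
        refine mul_left_cancel₀ hc0 ?_
        linarith
      rw [hc2]
      exact hB'
  refine (Set.encard_le_encard hsub).trans ((Set.encard_insert_le _ _).trans ?_)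
  rw [Set.encard_singleton, one_add_one_eq_two]

theorem mainTheorem8 (Z : Fin 3 → Pt 3) (hZ : ¬ Collinear ℝ {Z 0, Z 1, Z 2})
    (d : Fin 3 → ℝ) (hd : ∀ i, 0 ≤ d i) :
    ((minimizers sqError Z d).encard = 1 ∨ (minimizers sqError Z d).encard = 2) ∧
    (((commonSphere Z d).encard = 0 ∨ (commonSphere Z d).encard = 1) →
      (minimizers sqError Z d).encard = 1) ∧
    ((commonSphere Z d).encard = 2 → (minimizers sqError Z d).encard = 2) := by
  rcases (commonSphere Z d).eq_empty_or_nonempty with he | hne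
  · have h1 := minimizers_encard_eq_one Z hZ d hd he
    refine ⟨Or.inl h1, fun _ => h1, fun h2 => ?_⟩
    rw [he, Set.encard_empty] at h2
    exact absurd h2 (by norm_num)
  · rw [minimizers_eq_commonSphere Z d hd hne]
    have hle := commonSphere_encard_le_two Z hZ d
    have hpos : 1 ≤ (commonSphere Z d).encard := Set.one_le_encard_iff_nonempty.2 hne
    refine ⟨?_, fun h => h.resolve_left fun h0 => ?_, id⟩
    · rcases hpos.eq_or_lt with h | h
      · exact Or.inl h.symm
      · exact Or.inr (le_antisymm hle (by simpa [one_add_one_eq_two] using Order.add_one_le_of_lt h))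
    · rw [h0] at hpos
      exact absurd hpos (by norm_num)
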